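/- Let $\mathbb N=\{1,2,3,\dots\}$. For $p\in\mathbb N$, a $p$-periodic function $f:\mathbb R\to\mathbb R$ and a $p$-periodic measurable set $A\subset\mathbb R$ put $$\overline{\int} f=\frac1p\int_0^p f(x)\,dx,\qquad \overline\lambda(A)=\frac1p\,\lambda\bigl(A\cap[0,p)\bigr),$$ where $\lambda$ is Lebesgue measure. Fix real numbers $\frac12<\rho<1$, $0<\epsilon<\frac1{10}$ and an integer $M\ge 2$. For $\alpha,s\in\mathbb N$ and $\mathcal P\subset\mathbb N$, an $\alpha$-$\mathcal P$-$s$-family consists of integers $n\ge 1$ and $\omega\ge\alpha$, a number $p\in\mathcal P$ with $p\ge\omega$, and non-negative functions $\phi_i:\mathbb R\to\mathbb R$ $(i=1,\dots,n)$ and $\psi_k:\mathbb R\to\mathbb R$ $(k=\alpha,\dots,\omega)$, each of which is periodic by $p$ and constant on every interval $[m,m+1)$, $m\in\mathbb Z$, such that $$\overline\lambda\Bigl\{x:\ \max_{\alpha\le k\le\omega}\ \max_{1\le l\le p}\ \frac{\sum_{i=1}^{n}\phi_i(x+l)\,\psi_k(x+2l)}{l}\ge 1\Bigr\}>\min\Bigl\{\epsilon,\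 \frac{s(M-1)\,\epsilon\,2^{-M}}{2048}\Bigr\},$$ $$s\cdot2^{-M-1}<\sum_{i=1}^{n}\overline{\int}\phi_i<s\cdot2^{-M+1},\qquad \rho\,\epsilon<\sum_{k=\alpha}^{\omega}\overline{\int}\psi_k<\epsilon,$$ where $l$ ranges over integers. **Theorem.** For every infinite set $\mathcal P\subset\mathbb N$ and all $\alpha,s\in\mathbb N$ there exists an $\alpha$-$\mathcal P$-$s$-family. -/

import Mathlib

open MeasureTheory

/-- The mean value `(1/p) ∫_0^p f` of a `p`-periodic function `f : ℝ → ℝ`. -/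
noncomputable def periodMean (p : ℕ) (f : ℝ → ℝ) : ℝ :=
  (1 / (p : ℝ)) * ∫ x in (0 : ℝ)..(p : ℝ), f x

/-- The relative Lebesgue measure `(1/p) λ(A ∩ [0,p))` of a `p`-periodic set `A ⊆ ℝ`. -/
noncomputable def relMeasure (p : ℕ) (A : Set ℝ) : ℝ :=
  (1 / (p : ℝ)) * (volume (A ∩ Set.Ico (0 : ℝ) (p : ℝ))).toReal

/-- A non-negative function on `ℝ`, constant on each interval `[m, m+1)` with `m` an integer,
and periodic by `p`. -/
structure IsPeriodicStep (p : ℕ) (f : ℝ → ℝ) : Prop where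
  nonneg : ∀ x, 0 ≤ f x
  step : ∀ x : ℝ, f x = f (⌊x⌋ : ℝ)
  periodic : Function.Periodic f (p : ℝ)

/-- The set of all `x` with
`max_{α ≤ k ≤ ω} max_{1 ≤ l ≤ p} (∑_{i=1}^n φ_i(x+l) ψ_k(x+2l)) / l ≥ 1`.
A maximum over finitely many pairs `(k, l)` is at least `1` exactly when one of its terms is. -/
def largeSet (n α ω p : ℕ) (φ ψ : ℕ → ℝ → ℝ) : Set ℝ :=
  {x : ℝ | ∃ k ∈ Finset.Icc α ω, ∃ l ∈ Finset.Icc 1 p,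
    1 ≤ (∑ i ∈ Finset.Icc 1 n, φ i (x + (l : ℝ)) * ψ k (x + 2 * (l : ℝ))) / (l : ℝ)}

/-- An `α`-`P`-`s`-family (for the parameters `ρ`, `ε`, `M`) with `ψ`-interval `[α, ω]`.
Only `φ i` for `1 ≤ i ≤ n` and `ψ k` for `α ≤ k ≤ ω` belong to the family;
the values of `φ` and `ψ` at other indices play no role. -/
structure AlphaPSFamily (ρ ε : ℝ) (M : ℕ) (α : ℕ) (P : Set ℕ) (s : ℕ) where
  /-- the number of functions `φ_i` -/
  n : ℕ
  /-- the right endpoint of the `ψ`-interval -/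
  ω : ℕ
  /-- the common period -/
  p : ℕ
  /-- the functions `φ_1, …, φ_n` -/
  φ : ℕ → ℝ → ℝ
  /-- the functions `ψ_α, …, ψ_ω` -/
  ψ : ℕ → ℝ → ℝ
  α_le_ω : α ≤ ω
  p_mem : p ∈ P
  ω_le_p : ω ≤ p
  φ_step : ∀ i ∈ Finset.Icc 1 n, IsPeriodicStep p (φ i)
  ψ_step : ∀ k ∈ Finset.Icc α ω, IsPeriodicStep p (ψ k)
  relMeasure_gt :
    min ε ((s : ℝ) * ((M : ℝ) - 1) * ε * (2 : ℝ) ^ (-(M : ℤ)) / 2048) <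
      relMeasure p (largeSet n α ω p φ ψ)
  lt_sum_φ : (s : ℝ) * (2 : ℝ) ^ (-(M : ℤ) - 1) < ∑ i ∈ Finset.Icc 1 n, periodMean p (φ i)
  sum_φ_lt : ∑ i ∈ Finset.Icc 1 n, periodMean p (φ i) < (s : ℝ) * (2 : ℝ) ^ (-(M : ℤ) + 1)
  lt_sum_ψ : ρ * ε < ∑ k ∈ Finset.Icc α ω, periodMean p (ψ k)
  sum_ψ_lt : ∑ k ∈ Finset.Icc α ω, periodMean p (ψ k) < ε

/-!
The bilinear maximal operator `sup_l φ(x + l) ψ(x + 2l) / l` satisfies no weak-type estimate on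
`L¹ × L¹`: for a fixed large set where it is at least `1`, the product of the means of
`φ` and `ψ` can be made arbitrarily small. One pair `(φ, ψ)` then already forms a family: the large set
has relative measure at least `3 / 8 > ε`, and both functions can be enlarged to the required means.

Let heights `A, B ≥ 1` on the integers be given and let `φ(u) = A(u)` with probability `γ / A(u)`,
`ψ(v) = B(v)` with probability `γ / B(v)`, independently, and zero otherwise. Both means are about `γ`.
For fixed `x`, distinct `l` involve distinct variables, so `x` lies outside the large set with
probability at most `∏_l (1 - γ² / L(l)) ≤ exp (-γ² ∑_l 1 / L(l))`, where `L(l) = A(x + l) B(x + 2l)` and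
`l` runs over the shifts with `l ≤ L(l)`. Since these products are affine in each probability,
rounding the probabilities one at a time to `0` or `1` (`CoordAffine.exists_round`) replaces the
random choice in `exists_sparse_subsets`.

It remains to choose heights for which `∑_{l ≤ L(l)} 1 / L(l)` is large for most `x`. For constant
heights it is about `1`. With rapidly growing tile lengths `τ_0, …, τ_{K-1}`, binary digits `d_k` that
depend on the tile of length `τ_k`, and ratios `R_k`, put `A(y) = ∏ R_k ^ d_k(y)` and
`B(z) = ∏ R_k ^ (1 - d_k(z))`. If `k` is the highest level at which the digits of `x + l` and `x + 2l`
differ, being `1` and `0` there, then `L(l)` is comparable, up to smaller ratios, to `R_k ∏ R_j`, which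
lies between `τ_k` and `τ_{k+1}`. The shifts `l ≤ L(l)` of this kind have a positive proportion in
each period of the digits up to level `k`, so they contribute a constant to the sum
(`sum_levelShifts`). Different `k` give different shifts, so the sum is at least `K / 32`
(`sum_crossShifts`), except for the few `x` close to the end of a tile (`card_innerPoints`).
-/

/-! ### Digits, scales and heights -/

/-- The indicator (as an exponent `0` or `1`) of the first half of each period `4τ`: it is `1` when the
length-`τ` tile containing `y` has index `0` or `1` modulo `4`. With period `4`, every tile has a
shift `e` such that the tiles `X + e` and `X + 2e` have the digits `1` and `0`. -/
def digit (τ y : ℕ) : ℕ := if y / τ % 4 < 2 then 1 else 0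

/-- The product `Q_k = R_0 ⋯ R_{k-1}` of the scale ratios `R_k = scaleRatio D k`. The recursion is
chosen so that `R_k = 8 D Q_k²` holds. -/
def scaleProd (D : ℕ) : ℕ → ℕ
  | 0 => 1
  | k + 1 => 8 * D * scaleProd D k ^ 3

/-- The factor `R_k = 8 D Q_k²` that the digit of level `k` contributes to the heights. -/
def scaleRatio (D k : ℕ) : ℕ := 8 * D * scaleProd D k ^ 2

/-- The tile length `τ_k = D Q_K Q_k` of level `k` in a construction with `K` levels. It is at
most an eighth of each product of heights at two points whose highest separating level is `k`, and
`D` times the bound `Q_K Q_k` for such products when that level is lower than `k`. -/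
def blockLen (D K k : ℕ) : ℕ := scaleProd D K * D * scaleProd D k

/-- The height `∏_k R_k ^ digit_k(y)` of the first function at `y`, if it is non-zero there. -/
def heightΦ (D K y : ℕ) : ℕ :=
  ∏ k ∈ Finset.range K, scaleRatio D k ^ digit (blockLen D K k) y

/-- The height `∏_k R_k ^ (1 - digit_k(z))` of the second function at `z`, if it is non-zero there.
The digits enter with the opposite sign, so that a level at which `y` and `z` agree contributes
exactly the factor `R_k` to `heightΦ y * heightΨ z`. -/
def heightΨ (D K z : ℕ) : ℕ :=
  ∏ k ∈ Finset.range K, scaleRatio D k ^ (1 - digit (blockLen D K k) z)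

lemma digit_le_one (τ y : ℕ) : digit τ y ≤ 1 := by
  unfold digit; split_ifs <;> simp

lemma digit_add_mul {τ : ℕ} (hτ : 0 < τ) (y n : ℕ) : digit τ (y + τ * (4 * n)) = digit τ y := by
  unfold digit
  rw [Nat.add_mul_div_left _ _ hτ, Nat.add_mul_mod_self_left]

lemma digit_eq_of_mod_add_lt {τ x m : ℕ} (h : x % τ + m < τ) :
    digit τ (x + m) = digit τ x := by
  have hx : x + m = x % τ + m + τ * (x / τ) := by
    have := Nat.mod_add_div x τ
    omega
  have hτ : 0 < τ := by omega
  unfold digit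
  rw [hx, Nat.add_mul_div_left _ _ hτ, Nat.div_eq_of_lt h, zero_add]

lemma scaleProd_pos {D : ℕ} (hD : 0 < D) (k : ℕ) : 0 < scaleProd D k := by
  induction k with
  | zero => simp [scaleProd]
  | succ k ih => simp only [scaleProd]; positivity

lemma scaleRatio_pos {D : ℕ} (hD : 0 < D) (k : ℕ) : 0 < scaleRatio D k := by
  have := scaleProd_pos hD k
  unfold scaleRatio; positivity

lemma blockLen_pos {D : ℕ} (hD : 0 < D) (K k : ℕ) : 0 < blockLen D K k := by
  have := scaleProd_pos hD k
  have := scaleProd_pos hD K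
  unfold blockLen; positivity

lemma scaleProd_succ (D k : ℕ) : scaleProd D (k + 1) = scaleProd D k * scaleRatio D k := by
  simp only [scaleProd, scaleRatio]; ring

lemma prod_scaleRatio (D n : ℕ) : ∏ k ∈ Finset.range n, scaleRatio D k = scaleProd D n := by
  induction n with
  | zero => simp [scaleProd]
  | succ n ih => rw [Finset.prod_range_succ, ih, scaleProd_succ]

lemma scaleProd_dvd (D : ℕ) {j k : ℕ} (h : j ≤ k) : scaleProd D j ∣ scaleProd D k := by
  induction h with
  | refl => rfl
  | step _ ih => exact ih.trans (by rw [Nat.succ_eq_add_one, scaleProd_succ]; exact Dvd.intro _ rfl)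

lemma scaleProd_mono {D : ℕ} (hD : 0 < D) {j k : ℕ} (h : j ≤ k) : scaleProd D j ≤ scaleProd D k :=
  Nat.le_of_dvd (scaleProd_pos hD k) (scaleProd_dvd D h)

lemma blockLen_dvd (D K : ℕ) {j k : ℕ} (h : j ≤ k) : blockLen D K j ∣ blockLen D K k :=
  Nat.mul_dvd_mul_left _ (scaleProd_dvd D h)

lemma heightΦ_pos {D : ℕ} (hD : 0 < D) (K y : ℕ) : 0 < heightΦ D K y :=
  Finset.prod_pos fun k _ => pow_pos (scaleRatio_pos hD k) _

lemma heightΨ_pos {D : ℕ} (hD : 0 < D) (K y : ℕ) : 0 < heightΨ D K y :=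
  Finset.prod_pos fun k _ => pow_pos (scaleRatio_pos hD k) _

lemma heightΦ_mul_heightΨ (D K y z : ℕ) : heightΦ D K y * heightΨ D K z =
    ∏ k ∈ Finset.range K,
      scaleRatio D k ^ (digit (blockLen D K k) y + (1 - digit (blockLen D K k) z)) := by
  simp only [heightΦ, heightΨ, pow_add, Finset.prod_mul_distrib]

lemma prod_scaleRatio_pow_ite (D : ℕ) {K m : ℕ} (hm : m ≤ K) :
    ∏ j ∈ Finset.range K, scaleRatio D j ^ (if j < m then 1 else 0) = scaleProd D m := by
  rw [← prod_scaleRatio]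
  have : ∀ j, scaleRatio D j ^ (if j < m then 1 else 0) = if j < m then scaleRatio D j else 1 := by
    intro j; split_ifs <;> simp
  simp only [this]
  rw [← Finset.prod_filter]
  congr 1
  ext j; simp; omega

/-- The size of a product of heights whose highest separating level is `k`: the exponent there is `2`,
it is `1` above, and the lower levels are too small to matter. -/
lemma mul_le_of_exponents {D K k : ℕ} (hD : 0 < D) (hk : k < K) (e : ℕ → ℕ)
    (hek : e k = 2) (hup : ∀ j, k < j → j < K → e j = 1) (hle : ∀ j, e j ≤ 2) :
    8 * blockLen D K k ≤ ∏ j ∈ Finset.range K, scaleRatio D j ^ e j ∧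
    ∏ j ∈ Finset.range K, scaleRatio D j ^ e j ≤ scaleProd D K * scaleProd D (k + 1) := by
  have hQ := scaleProd_pos hD k
  constructor
  -- compare the exponents factor by factor after multiplying by powers `Q_m = ∏_{j < m} R_j`
  · have h1 : scaleProd D K * scaleProd D (k + 1) ≤
        (∏ j ∈ Finset.range K, scaleRatio D j ^ e j) * (scaleProd D k * scaleProd D k) := by
      rw [← prod_scaleRatio D K, ← prod_scaleRatio_pow_ite D (Nat.succ_le_of_lt hk),
        ← prod_scaleRatio_pow_ite D hk.le, ← Finset.prod_mul_distrib, ← Finset.prod_mul_distrib,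
        ← Finset.prod_mul_distrib]
      refine Finset.prod_le_prod' fun j hj => ?_
      rw [← pow_add, ← pow_add, ← pow_succ']
      refine Nat.pow_le_pow_right (scaleRatio_pos hD j) ?_
      rcases lt_trichotomy j k with h | h | h
      · simp [h, Nat.lt_succ_of_lt h]
      · subst h; simp [hek]
      · have := hup j h (Finset.mem_range.1 hj)
        simp [this, h.not_gt, show ¬ j < k.succ by omega]
    rw [scaleProd] at h1
    have h2 : 8 * blockLen D K k * (scaleProd D k * scaleProd D k) =
        scaleProd D K * (8 * D * scaleProd D k ^ 3) := by unfold blockLen; ring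
    exact Nat.le_of_mul_le_mul_right (h2 ▸ h1) (by positivity)
  · rw [← prod_scaleRatio D K, ← prod_scaleRatio_pow_ite D (Nat.succ_le_of_lt hk),
      ← Finset.prod_mul_distrib]
    refine Finset.prod_le_prod' fun j hj => ?_
    rw [← pow_succ']
    refine Nat.pow_le_pow_right (scaleRatio_pos hD j) ?_
    rcases le_or_gt j k with h | h
    · simpa [Nat.lt_succ_of_le h] using hle j
    · have := hup j h (Finset.mem_range.1 hj)
      omega

/-! ### Shifts that separate points at a given level -/

lemma exists_tile_shift (X : ℕ) : ∃ e, 1 ≤ e ∧ e ≤ 3 ∧ (X + e) % 4 < 2 ∧ ¬ (X + 2 * e) % 4 < 2 := by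
  have : X % 4 < 4 := Nat.mod_lt _ (by norm_num)
  obtain h | h | h | h : X % 4 = 0 ∨ X % 4 = 1 ∨ X % 4 = 2 ∨ X % 4 = 3 := by omega
  · exact ⟨1, by omega⟩
  · exact ⟨3, by omega⟩
  · exact ⟨2, by omega⟩
  · exact ⟨2, by omega⟩

/-- For every `x`, at least a sixteenth of the shifts `l` in a period `4τ`, `τ = 4w`, put `x + l` in a
tile of digit `1` and `x + 2l` in a tile of digit `0`. -/
lemma exists_shifts {w : ℕ} (hw : 0 < w) (x : ℕ) : ∃ G : Finset ℕ, G.card = w ∧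
    ∀ l ∈ G, 1 ≤ l ∧ l ≤ 4 * (4 * w) ∧ digit (4 * w) (x + l) = 1 ∧
      digit (4 * w) (x + 2 * l) = 0 := by
  obtain ⟨e, he1, he3, h1, h2⟩ := exists_tile_shift (x / (4 * w))
  have hτ : 0 < 4 * w := by omega
  have hρ := Nat.mod_lt x hτ
  have hx := Nat.mod_add_div x (4 * w)
  set ρ := x % (4 * w)
  set X := x / (4 * w)
  have key : ∀ l a b, x + l = a + (4 * w) * (X + e) → x + 2 * l = b + (4 * w) * (X + 2 * e) →
      a < 4 * w → b < 4 * w → digit (4 * w) (x + l) = 1 ∧ digit (4 * w) (x + 2 * l) = 0 := by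
    intro l a b ha hb ha' hb'
    unfold digit
    rw [ha, hb, Nat.add_mul_div_left _ _ hτ, Nat.add_mul_div_left _ _ hτ, Nat.div_eq_of_lt ha',
      Nat.div_eq_of_lt hb', zero_add, zero_add, if_pos h1, if_neg h2]
    exact ⟨rfl, rfl⟩
  have hwe : w ≤ w * e := Nat.le_mul_of_pos_right _ he1
  have hwe' : w * e ≤ w * 3 := Nat.mul_le_mul_left _ he3
  -- shift by `e` tiles, and then by at most `τ / 4` away from the nearer end of the tile of `x`
  by_cases hc : 2 * ρ < 4 * w
  · refine ⟨(Finset.range w).image (fun f => 4 * w * e + f), ?_, ?_⟩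
    · rw [Finset.card_image_of_injective _ (fun a b h => by simpa using h), Finset.card_range]
    · intro l hl
      obtain ⟨f, hf, rfl⟩ := Finset.mem_image.1 hl
      rw [Finset.mem_range] at hf
      have hmul : 4 * w * e = 4 * (w * e) := by ring
      refine ⟨by omega, by omega, key _ (ρ + f) (ρ + 2 * f) ?_ ?_ (by omega) (by omega)⟩
      · rw [← hx]; ring
      · rw [← hx]; ring
  · refine ⟨(Finset.range w).image (fun f => 4 * w * e - f), ?_, ?_⟩
    · have hmul : 4 * w * e = 4 * (w * e) := by ring
      rw [Finset.card_image_of_injOn, Finset.card_range]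
      intro a ha b hb h
      simp only [Finset.coe_range, Set.mem_Iio] at ha hb
      simp only at h
      omega
    · intro l hl
      obtain ⟨f, hf, rfl⟩ := Finset.mem_image.1 hl
      rw [Finset.mem_range] at hf
      have hmul : 4 * w * e = 4 * (w * e) := by ring
      have e1 : (4 * w) * (X + e) = 4 * w * X + 4 * w * e := by ring
      have e2 : (4 * w) * (X + 2 * e) = 4 * w * X + 2 * (4 * w * e) := by ring
      refine ⟨by omega, by omega, key _ (ρ - f) (ρ - 2 * f) ?_ ?_ (by omega) (by omega)⟩
      · omega
      · omega

/-- `x` is so far from the right end of its tile, at every level, that the shifts belonging to lower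
levels do not leave the tile. -/
def IsInner (D K x : ℕ) : Prop :=
  ∀ j < K, x % blockLen D K j + 2 * (scaleProd D K * scaleProd D j) < blockLen D K j

/-- The shifts `l` that are at most the product of heights at `x + l` and `x + 2l` and separate these two
points at level `k`; the bound on `l` makes the higher digits agree when `x` is inner. -/
def levelShifts (D K x k : ℕ) : Finset ℕ :=
  (Finset.Icc 1 (scaleProd D K * scaleProd D (k + 1))).filter fun l =>
    l ≤ heightΦ D K (x + l) * heightΨ D K (x + 2 * l) ∧
    digit (blockLen D K k) (x + l) = 1 ∧ digit (blockLen D K k) (x + 2 * l) = 0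

lemma IsInner.digit_eq {D K x k j l : ℕ} (hD : 0 < D) (hx : IsInner D K x) (hkj : k < j)
    (hj : j < K) (hl : l ≤ scaleProd D K * scaleProd D (k + 1)) :
    digit (blockLen D K j) (x + l) = digit (blockLen D K j) x ∧
      digit (blockLen D K j) (x + 2 * l) = digit (blockLen D K j) x := by
  have h1 := hx j hj
  have h2 : scaleProd D K * scaleProd D (k + 1) ≤ scaleProd D K * scaleProd D j :=
    Nat.mul_le_mul_left _ (scaleProd_mono hD hkj)
  exact ⟨digit_eq_of_mod_add_lt (by omega), digit_eq_of_mod_add_lt (by omega)⟩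

/-- Each level contributes at least `1 / 32`. Up to the higher digits, which agree, the product `v` of
heights is periodic in `l` with period `4τ_k`. A residue class on which it is `v ≥ 8τ_k` contains at
least `v / (8τ_k)` admissible shifts, each of weight `1 / v`, whatever `v` is. -/
lemma sum_levelShifts {D K x k : ℕ} (hD : 0 < D) (hD4 : 4 ∣ D) (hx : IsInner D K x) (hk : k < K) :
    (1 / 32 : ℝ) ≤ ∑ l ∈ levelShifts D K x k,
      1 / ((heightΦ D K (x + l) : ℝ) * heightΨ D K (x + 2 * l)) := by
  obtain ⟨w, hw⟩ : 4 ∣ blockLen D K k := by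
    unfold blockLen
    exact Dvd.dvd.mul_right (Dvd.dvd.mul_left hD4 _) _
  have hτ := blockLen_pos hD K k
  have hw0 : 0 < w := by omega
  obtain ⟨G, hGc, hG⟩ := exists_shifts hw0 x
  rw [← hw] at hG
  set τ := blockLen D K k with hτd
  -- the exponents of the ratios, with the digits above level `k` replaced by their common value
  let e : ℕ → ℕ → ℕ := fun l j => if k < j then 1 else
    digit (blockLen D K j) (x + l) + (1 - digit (blockLen D K j) (x + 2 * l))
  let v : ℕ → ℕ := fun l => ∏ j ∈ Finset.range K, scaleRatio D j ^ e l j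
  have hv : ∀ l ∈ G, 8 * τ ≤ v l ∧ v l ≤ scaleProd D K * scaleProd D (k + 1) := by
    intro l hl
    obtain ⟨-, -, h1, h2⟩ := hG l hl
    refine mul_le_of_exponents hD hk (e l) ?_ ?_ ?_
    · simp [e, ← hτd, h1, h2]
    · intro j hj _; simp [e, hj]
    · intro j
      have := digit_le_one (blockLen D K j) (x + l)
      simp only [e]; split_ifs <;> omega
  have hper : ∀ l n, v (l + n * (4 * τ)) = v l := by
    intro l n
    refine Finset.prod_congr rfl fun j _ => ?_
    congr 1
    simp only [e]
    split_ifs with h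
    · rfl
    · obtain ⟨c, hc⟩ := blockLen_dvd D K (not_lt.1 h)
      have hj := blockLen_pos hD K j
      have e1 : x + (l + n * (4 * τ)) = x + l + blockLen D K j * (4 * (n * c)) := by
        rw [hτd, hc]; ring
      have e2 : x + 2 * (l + n * (4 * τ)) = x + 2 * l + blockLen D K j * (4 * (2 * n * c)) := by
        rw [hτd, hc]; ring
      rw [e1, e2, digit_add_mul hj, digit_add_mul hj]
  have hheight : ∀ l, l ≤ scaleProd D K * scaleProd D (k + 1) →
      heightΦ D K (x + l) * heightΨ D K (x + 2 * l) = v l := by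
    intro l hl
    rw [heightΦ_mul_heightΨ]
    refine Finset.prod_congr rfl fun j hj => ?_
    congr 1
    simp only [e]
    split_ifs with h
    · obtain ⟨h1, h2⟩ := hx.digit_eq hD h (Finset.mem_range.1 hj) hl
      have := digit_le_one (blockLen D K j) x
      omega
    · rfl
  -- the pair `(l, n)` stands for the shift `l + n * 4τ`, which is at most `v l`
  let S : Finset (Σ _ : ℕ, ℕ) := G.sigma fun l => Finset.range (v l / (4 * τ))
  let f : (Σ _ : ℕ, ℕ) → ℕ := fun s => s.1 + s.2 * (4 * τ)
  have hfle : ∀ s ∈ S, f s ≤ v s.1 := by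
    intro s hs
    obtain ⟨h1, h2⟩ := Finset.mem_sigma.1 hs
    have h3 : s.2 + 1 ≤ v s.1 / (4 * τ) := Finset.mem_range.1 h2
    have h4 := Nat.mul_le_of_le_div _ _ _ h3
    have h5 := (hG _ h1).2.1
    have h6 : (s.2 + 1) * (4 * τ) = s.2 * (4 * τ) + 4 * τ := by ring
    simp only [f]; omega
  have hfinj : Set.InjOn f S := by
    rintro ⟨l, n⟩ hs ⟨l', n'⟩ hs' h
    have h1 := hG _ (Finset.mem_sigma.1 (Finset.mem_coe.1 hs)).1
    have h1' := hG _ (Finset.mem_sigma.1 (Finset.mem_coe.1 hs')).1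
    simp only at h1 h1'
    simp only [f] at h
    have hn : n = n' := by
      rcases lt_trichotomy n n' with hlt | heq | hlt
      · have := Nat.mul_le_mul_right (4 * τ) (Nat.succ_le_of_lt hlt)
        rw [Nat.succ_mul] at this
        omega
      · exact heq
      · have := Nat.mul_le_mul_right (4 * τ) (Nat.succ_le_of_lt hlt)
        rw [Nat.succ_mul] at this
        omega
    subst hn
    have : l = l' := by omega
    subst this
    rfl
  have hsub : S.image f ⊆ levelShifts D K x k := by
    intro m hm
    obtain ⟨s, hs, rfl⟩ := Finset.mem_image.1 hm
    have h1 := (Finset.mem_sigma.1 hs).1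
    obtain ⟨g1, -, g2, g3⟩ := hG _ h1
    have h2 := hfle s hs
    have h3 := h2.trans (hv _ h1).2
    simp only [levelShifts, Finset.mem_filter, Finset.mem_Icc]
    refine ⟨⟨le_trans g1 (Nat.le_add_right _ _), h3⟩, ?_, ?_, ?_⟩
    · rw [hheight _ h3]; simp only [f]; rw [hper]; exact h2
    · have e1 : x + f s = x + s.1 + τ * (4 * s.2) := by simp only [f]; ring
      rw [← hτd, e1, digit_add_mul hτ, g2]
    · have e1 : x + 2 * f s = x + 2 * s.1 + τ * (4 * (2 * s.2)) := by simp only [f]; ring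
      rw [← hτd, e1, digit_add_mul hτ, g3]
  calc (1 / 32 : ℝ) = ∑ l ∈ G, 1 / (8 * (τ : ℝ)) := by
        rw [Finset.sum_const, hGc, hw]
        have : (w : ℝ) ≠ 0 := by positivity
        push_cast
        rw [nsmul_eq_mul]; field_simp; norm_num
    _ ≤ ∑ l ∈ G, ∑ n ∈ Finset.range (v l / (4 * τ)), 1 / (v l : ℝ) := by
        refine Finset.sum_le_sum fun l hl => ?_
        have h8 := (hv l hl).1
        rw [Finset.sum_const, Finset.card_range, nsmul_eq_mul]
        have hvpos : (0 : ℝ) < v l := by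
          have : 0 < v l := by omega
          exact_mod_cast this
        have h1 : v l ≤ 8 * τ * (v l / (4 * τ)) := by
          have h3 := Nat.div_add_mod (v l) (4 * τ)
          have h4 := Nat.mod_lt (v l) (show 0 < 4 * τ by omega)
          have h5 : 1 ≤ v l / (4 * τ) := (Nat.one_le_div_iff (by omega)).2 (by omega)
          have h6 := Nat.mul_le_mul_left (4 * τ) h5
          have h7 : 8 * τ * (v l / (4 * τ)) = 2 * (4 * τ * (v l / (4 * τ))) := by ring
          omega
        have h2 : (v l : ℝ) ≤ 8 * τ * ((v l / (4 * τ) : ℕ) : ℝ) := by exact_mod_cast h1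
        have hτ' : (0 : ℝ) < τ := by exact_mod_cast hτ
        rw [mul_one_div, div_le_div_iff₀ (by positivity) hvpos]
        linarith
    _ = ∑ s ∈ S, 1 / (v s.1 : ℝ) := (Finset.sum_sigma G _ (fun s => 1 / (v s.1 : ℝ))).symm
    _ = ∑ s ∈ S, 1 / ((heightΦ D K (x + f s) : ℝ) * heightΨ D K (x + 2 * f s)) := by
        refine Finset.sum_congr rfl fun s hs => ?_
        have h3 := (hfle s hs).trans (hv _ (Finset.mem_sigma.1 hs).1).2
        have h4 := hheight _ h3
        rw [show v (f s) = v s.1 from hper _ _] at h4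
        rw [← h4]; push_cast; rfl
    _ = ∑ l ∈ S.image f, 1 / ((heightΦ D K (x + l) : ℝ) * heightΨ D K (x + 2 * l)) :=
        (Finset.sum_image (f := fun l : ℕ =>
          1 / ((heightΦ D K (x + l) : ℝ) * heightΨ D K (x + 2 * l))) hfinj).symm
    _ ≤ _ := Finset.sum_le_sum_of_subset_of_nonneg hsub fun _ _ _ => by positivity

/-- The shifts `l` for which non-zero values at `x + l` and `x + 2l` make the quotient at `x` at least
`1`. -/
def crossShifts (D K x : ℕ) : Finset ℕ :=
  (Finset.Icc 1 (scaleProd D K ^ 2)).filter fun l =>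
    l ≤ heightΦ D K (x + l) * heightΨ D K (x + 2 * l)

/-- The levels contribute disjoint sets of shifts, because the highest level that separates `x + l` from
`x + 2l` is unique. -/
lemma sum_crossShifts {D K x : ℕ} (hD : 0 < D) (hD4 : 4 ∣ D) (hx : IsInner D K x) :
    (K / 32 : ℝ) ≤ ∑ l ∈ crossShifts D K x,
      1 / ((heightΦ D K (x + l) : ℝ) * heightΨ D K (x + 2 * l)) := by
  have hdisj : Set.PairwiseDisjoint (Finset.range K : Set ℕ) (levelShifts D K x) := by
    have key : ∀ k j, k < j → j < K → Disjoint (levelShifts D K x k) (levelShifts D K x j) := by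
      intro k j hkj hj
      rw [Finset.disjoint_left]
      intro l hl hl'
      simp only [levelShifts, Finset.mem_filter, Finset.mem_Icc] at hl hl'
      have := hx.digit_eq hD hkj hj hl.1.2
      omega
    intro k hk j hj hkj
    simp only [Finset.coe_range, Set.mem_Iio] at hk hj
    rcases lt_or_gt_of_ne hkj with h | h
    · exact key k j h hj
    · exact (key j k h hk).symm
  have hsub : (Finset.range K).biUnion (levelShifts D K x) ⊆ crossShifts D K x := by
    intro l hl
    obtain ⟨k, hk, hl⟩ := Finset.mem_biUnion.1 hl
    simp only [levelShifts, crossShifts, Finset.mem_filter, Finset.mem_Icc] at hl ⊢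
    refine ⟨⟨hl.1.1, hl.1.2.trans ?_⟩, hl.2.1⟩
    rw [sq]
    exact Nat.mul_le_mul_left _ (scaleProd_mono hD (Finset.mem_range.1 hk))
  calc (K / 32 : ℝ) = ∑ k ∈ Finset.range K, (1 / 32 : ℝ) := by
        rw [Finset.sum_const, Finset.card_range, nsmul_eq_mul]; ring
    _ ≤ ∑ k ∈ Finset.range K, ∑ l ∈ levelShifts D K x k,
          1 / ((heightΦ D K (x + l) : ℝ) * heightΨ D K (x + 2 * l)) :=
        Finset.sum_le_sum fun k hk => sum_levelShifts hD hD4 hx (Finset.mem_range.1 hk)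
    _ = _ := (Finset.sum_biUnion hdisj).symm
    _ ≤ _ := Finset.sum_le_sum_of_subset_of_nonneg hsub fun _ _ _ => by positivity

/-! ### Counting inner points -/

lemma card_filter_mod_le {p τ m : ℕ} (hτ : 0 < τ) (hτp : τ ≤ p) :
    ((Finset.range p).filter fun x => ¬ x % τ + m < τ).card * τ ≤ 2 * p * m := by
  have h1 : ((Finset.range p).filter fun x => ¬ x % τ + m < τ).card ≤
      (Finset.range (p / τ + 1) ×ˢ Finset.Ico (τ - m) τ).card := by
    refine Finset.card_le_card_of_injOn (fun x => (x / τ, x % τ)) ?_ ?_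
    · intro x hx
      have hx' := Finset.mem_filter.1 (Finset.mem_coe.1 hx)
      have h2 := Nat.mod_lt x hτ
      have h3 : x / τ ≤ p / τ := Nat.div_le_div_right (Finset.mem_range.1 hx'.1).le
      simp only [Finset.coe_product, Set.mem_prod, Finset.mem_coe, Finset.mem_range, Finset.mem_Ico]
      omega
    · intro x _ y _ h
      rw [Prod.mk.injEq] at h
      rw [← Nat.div_add_mod x τ, ← Nat.div_add_mod y τ, h.1, h.2]
  rw [Finset.card_product, Finset.card_range, Nat.card_Ico] at h1
  have h2 : (p / τ + 1) * τ ≤ 2 * p := by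
    have := Nat.div_mul_le_self p τ
    rw [add_mul]; omega
  calc _ ≤ (p / τ + 1) * (τ - (τ - m)) * τ := Nat.mul_le_mul_right _ h1
    _ = ((p / τ + 1) * τ) * (τ - (τ - m)) := by ring
    _ ≤ 2 * p * m := Nat.mul_le_mul h2 (by omega)

open Classical in
/-- The inner points of `[0, p)` all of whose shifts stay below `p`, so that no wrapping around occurs. -/
noncomputable def innerPoints (D K p : ℕ) : Finset ℕ :=
  (Finset.range p).filter fun x => x + 2 * scaleProd D K ^ 2 < p ∧ IsInner D K x

lemma mem_innerPoints {D K p x : ℕ} : x ∈ innerPoints D K p ↔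
    x < p ∧ x + 2 * scaleProd D K ^ 2 < p ∧ IsInner D K x := by
  simp [innerPoints]

lemma card_innerPoints {D K p : ℕ} (hD : 0 < D) (hDK : 128 * K ≤ D)
    (hp : 64 * D * scaleProd D K ^ 2 ≤ p) :
    (15 / 16 * p : ℝ) ≤ (innerPoints D K p).card := by
  classical
  set C := scaleProd D K with hC
  have hCpos : 0 < C := scaleProd_pos hD K
  have hsub : Finset.range p ⊆ innerPoints D K p ∪ (Finset.Ico (p - 2 * C ^ 2) p ∪
      (Finset.range K).biUnion fun j => (Finset.range p).filter fun x =>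
        ¬ x % blockLen D K j + 2 * (scaleProd D K * scaleProd D j) < blockLen D K j) := by
    intro x hx
    by_cases h1 : x + 2 * C ^ 2 < p
    · by_cases h2 : IsInner D K x
      · exact Finset.mem_union_left _ (Finset.mem_filter.2 ⟨hx, h1, h2⟩)
      · obtain ⟨j, hj, h3⟩ : ∃ j < K, ¬ x % blockLen D K j +
            2 * (scaleProd D K * scaleProd D j) < blockLen D K j := by
          simpa only [IsInner, not_forall, exists_prop] using h2
        exact Finset.mem_union_right _ (Finset.mem_union_right _ (Finset.mem_biUnion.2
          ⟨j, Finset.mem_range.2 hj, Finset.mem_filter.2 ⟨hx, h3⟩⟩))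
    · have := Finset.mem_range.1 hx
      exact Finset.mem_union_right _ (Finset.mem_union_left _ (Finset.mem_Ico.2 (by omega)))
  have hlevel : ∀ j ∈ Finset.range K, ((Finset.range p).filter fun x =>
      ¬ x % blockLen D K j + 2 * (scaleProd D K * scaleProd D j) < blockLen D K j).card * D
        ≤ 4 * p := by
    intro j hj
    have hQ := scaleProd_pos hD j
    have hQC : scaleProd D j ≤ C := scaleProd_mono hD (Finset.mem_range.1 hj).le
    have hτp : blockLen D K j ≤ p := by
      refine le_trans ?_ hp
      calc blockLen D K j = D * (C * scaleProd D j) := by unfold blockLen; ring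
        _ ≤ D * (C * C) := by gcongr
        _ ≤ 64 * (D * (C * C)) := by omega
        _ = _ := by ring
    have h1 := card_filter_mod_le (m := 2 * (C * scaleProd D j)) (blockLen_pos hD K j) hτp
    have h2 : 0 < C * scaleProd D j := by positivity
    refine Nat.le_of_mul_le_mul_right ?_ h2
    calc _ = ((Finset.range p).filter fun x => ¬ x % blockLen D K j +
          2 * (scaleProd D K * scaleProd D j) < blockLen D K j).card * blockLen D K j := by
          rw [blockLen, ← hC]; ring
      _ ≤ 2 * p * (2 * (C * scaleProd D j)) := h1
      _ = _ := by ring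
  have h1 := (Finset.card_le_card hsub).trans ((Finset.card_union_le _ _).trans
    (Nat.add_le_add_left ((Finset.card_union_le _ _).trans
      (Nat.add_le_add_left Finset.card_biUnion_le _)) _))
  have h2 := Finset.sum_le_sum hlevel
  rw [← Finset.sum_mul, Finset.sum_const, Finset.card_range, smul_eq_mul] at h2
  rw [Finset.card_range, Nat.card_Ico] at h1
  set N := ∑ j ∈ Finset.range K, ((Finset.range p).filter fun x =>
      ¬ x % blockLen D K j + 2 * (scaleProd D K * scaleProd D j) < blockLen D K j).card
  have h3 : N * 32 ≤ p := by
    refine Nat.le_of_mul_le_mul_right ?_ hD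
    calc N * 32 * D = 32 * (N * D) := by ring
      _ ≤ 32 * (K * (4 * p)) := Nat.mul_le_mul_left _ h2
      _ = 128 * K * p := by ring
      _ ≤ D * p := Nat.mul_le_mul_right _ hDK
      _ = p * D := mul_comm _ _
  have h4 : 64 * C ^ 2 ≤ p := le_trans (by nlinarith [Nat.mul_le_mul_right (C ^ 2) hD]) hp
  have h5 : 15 * p ≤ 16 * (innerPoints D K p).card := by omega
  have h6 : (15 * p : ℝ) ≤ 16 * (innerPoints D K p).card := by exact_mod_cast h5
  linarith

/-! ### Rounding coordinatewise affine functions -/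

/-- `F` is affine in each coordinate separately. -/
def CoordAffine (F : (ℕ → ℝ) → ℝ) : Prop :=
  ∀ e i, ∃ c d : ℝ, ∀ t, F (Function.update e i t) = c + d * t

namespace CoordAffine

lemma const (c : ℝ) : CoordAffine fun _ => c := fun _ _ => ⟨c, 0, fun t => by ring⟩

lemma eval (j : ℕ) : CoordAffine fun e => e j := by
  intro e i
  by_cases h : j = i
  · subst h; exact ⟨0, 1, fun t => by simp⟩
  · exact ⟨e j, 0, fun t => by simp [Function.update_of_ne h]⟩

lemma add {F G : (ℕ → ℝ) → ℝ} (hF : CoordAffine F) (hG : CoordAffine G) :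
    CoordAffine fun e => F e + G e := by
  intro e i
  obtain ⟨c, d, h⟩ := hF e i
  obtain ⟨c', d', h'⟩ := hG e i
  exact ⟨c + c', d + d', fun t => by simp only [h, h']; ring⟩

lemma const_mul {F : (ℕ → ℝ) → ℝ} (hF : CoordAffine F) (a : ℝ) :
    CoordAffine fun e => a * F e := by
  intro e i
  obtain ⟨c, d, h⟩ := hF e i
  exact ⟨a * c, a * d, fun t => by simp only [h]; ring⟩

lemma sum {ι : Type*} (s : Finset ι) {F : ι → (ℕ → ℝ) → ℝ} (hF : ∀ i ∈ s, CoordAffine (F i)) :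
    CoordAffine fun e => ∑ i ∈ s, F i e := by
  classical
  induction s using Finset.induction_on with
  | empty => simpa using const 0
  | insert a s ha ih =>
    simp only [Finset.sum_insert ha]
    exact (hF a (Finset.mem_insert_self _ _)).add
      (ih fun i hi => hF i (Finset.mem_insert_of_mem hi))

/-- Distinct factors involve distinct coordinates, which is where injectivity of `χ` is used. -/
lemma prod_one_sub (G : Finset ℕ) {χ : ℕ → ℕ} (hχ : Function.Injective χ) (g : ℕ → ℝ) :
    CoordAffine fun e => ∏ l ∈ G, (1 - g l * e (χ l)) := by
  classical
  intro e i
  by_cases h : ∃ l ∈ G, χ l = i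
  · obtain ⟨l, hl, rfl⟩ := h
    refine ⟨∏ m ∈ G.erase l, (1 - g m * e (χ m)),
      -(g l * ∏ m ∈ G.erase l, (1 - g m * e (χ m))), fun t => ?_⟩
    have h2 : ∏ m ∈ G.erase l, (1 - g m * Function.update e (χ l) t (χ m)) =
        ∏ m ∈ G.erase l, (1 - g m * e (χ m)) :=
      Finset.prod_congr rfl fun m hm => by
        rw [Function.update_of_ne (hχ.ne (Finset.ne_of_mem_erase hm))]
    simp only
    rw [← Finset.mul_prod_erase _ _ hl, h2, Function.update_self]
    ring
  · push Not at h
    refine ⟨∏ l ∈ G, (1 - g l * e (χ l)), 0, fun t => ?_⟩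
    rw [zero_mul, add_zero]
    exact Finset.prod_congr rfl fun l hl => by rw [Function.update_of_ne (h l hl)]

/-- A function affine in each coordinate can be rounded to a vertex of the cube without increasing it.
This replaces choosing independent random values with means `q`. -/
lemma exists_round {F : (ℕ → ℝ) → ℝ} (hF : CoordAffine F) (s : Finset ℕ) (q : ℕ → ℝ)
    (hq : ∀ i, 0 ≤ q i ∧ q i ≤ 1) :
    ∃ e : ℕ → ℝ, (∀ i ∈ s, e i = 0 ∨ e i = 1) ∧ (∀ i ∉ s, e i = q i) ∧ F e ≤ F q := by
  classical
  induction s using Finset.induction_on with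
  | empty => exact ⟨q, by simp, by simp, le_rfl⟩
  | insert a s ha ih =>
    obtain ⟨e, h1, h2, h3⟩ := ih
    obtain ⟨c, d, h⟩ := hF e a
    obtain ⟨t, ht, htF⟩ : ∃ t : ℝ, (t = 0 ∨ t = 1) ∧ F (Function.update e a t) ≤ F e := by
      have he : F e = c + d * q a := by rw [← h, ← h2 a ha, Function.update_eq_self]
      rcases le_total 0 d with hd | hd
      · exact ⟨0, Or.inl rfl, by rw [h, he]; nlinarith [hq a]⟩
      · exact ⟨1, Or.inr rfl, by rw [h, he]; nlinarith [hq a]⟩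
    refine ⟨Function.update e a t, ?_, ?_, htF.trans h3⟩
    · intro i hi
      by_cases hia : i = a
      · subst hia; simpa using ht
      · rw [Function.update_of_ne hia]
        exact h1 i (Finset.mem_of_mem_insert_of_ne hi hia)
    · intro i hi
      rw [Finset.mem_insert, not_or] at hi
      rw [Function.update_of_ne hi.1, h2 i hi.2]

end CoordAffine

/-! ### Sparse sets meeting most points -/

lemma prod_one_sub_le {G : Finset ℕ} {c : ℕ → ℝ} (h1 : ∀ l ∈ G, c l ≤ 1)
    (h15 : 15 ≤ ∑ l ∈ G, c l) : ∏ l ∈ G, (1 - c l) ≤ 1 / 16 := by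
  have h2 : ∏ l ∈ G, (1 - c l) ≤ Real.exp (-∑ l ∈ G, c l) := by
    rw [← Finset.sum_neg_distrib, Real.exp_sum]
    refine Finset.prod_le_prod (fun l hl => by linarith [h1 l hl]) fun l _ => ?_
    have := Real.add_one_le_exp (-c l)
    linarith
  have h3 := Real.add_one_le_exp (∑ l ∈ G, c l)
  refine h2.trans ?_
  rw [Real.exp_neg, ← one_div]
  exact one_div_le_one_div_of_le (by norm_num) (by linarith)

/-- If every `x ∈ X` has large total weight `∑ 1 / (A(x + l) B(x + 2l))`, then there are sparse sets,
with indicators `e` and `f`, such that `A e` and `B f` have means `O(γ)` and most `x ∈ X` have a shift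
`l` with `x + l` in the first set and `x + 2l` in the second. The sets are obtained by rounding the
densities `γ / A` and `γ / B`. -/
lemma exists_sparse_subsets {p : ℕ} (hp : 0 < p) {A B : ℕ → ℝ} (hA : ∀ u, 1 ≤ A u)
    (hB : ∀ v, 1 ≤ B v) {γ : ℝ} (hγ : 0 < γ) (hγ1 : γ ≤ 1) (X : Finset ℕ)
    (hX : X.card ≤ p) (G : ℕ → Finset ℕ)
    (hG : ∀ x ∈ X, 15 ≤ γ ^ 2 * ∑ l ∈ G x, 1 / (A (x + l) * B (x + 2 * l)))
    (hGp : ∀ x ∈ X, ∀ l ∈ G x, x + 2 * l < p) :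
    ∃ e f : ℕ → ℝ, (∀ i < p, e i = 0 ∨ e i = 1) ∧ (∀ i < p, f i = 0 ∨ f i = 1) ∧
      ∑ u ∈ Finset.range p, A u * e u ≤ 9 / 4 * γ * p ∧
      ∑ v ∈ Finset.range p, B v * f v ≤ 9 / 4 * γ * p ∧
      ∃ Y ⊆ X, (X.card : ℝ) - 9 / 16 * p ≤ Y.card ∧
        ∀ x ∈ Y, ∃ l ∈ G x, e (x + l) = 1 ∧ f (x + 2 * l) = 1 := by
  classical
  have hA0 : ∀ u, 0 < A u := fun u => by linarith [hA u]
  have hB0 : ∀ u, 0 < B u := fun u => by linarith [hB u]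
  -- for `0`-`1` values, the last sum counts the points `x` without a suitable shift
  let F : (ℕ → ℝ) → (ℕ → ℝ) → ℝ := fun e f =>
    1 / (4 * γ) * ∑ u ∈ Finset.range p, A u * e u + 1 / (4 * γ) * ∑ v ∈ Finset.range p, B v * f v
      + ∑ x ∈ X, ∏ l ∈ G x, (1 - e (x + l) * f (x + 2 * l))
  have hF1 : ∀ f, CoordAffine fun e => F e f := by
    intro f
    refine CoordAffine.add (CoordAffine.add (CoordAffine.const_mul
      (CoordAffine.sum _ fun u _ => (CoordAffine.eval u).const_mul _) _) (CoordAffine.const _))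
      (CoordAffine.sum _ fun x _ => ?_)
    simpa only [mul_comm] using CoordAffine.prod_one_sub (G x)
      (χ := fun l => x + l) (fun a b h => by simpa using h) (fun l => f (x + 2 * l))
  have hF2 : ∀ e, CoordAffine fun f => F e f := by
    intro e
    refine CoordAffine.add (CoordAffine.add (CoordAffine.const _) (CoordAffine.const_mul
      (CoordAffine.sum _ fun u _ => (CoordAffine.eval u).const_mul _) _))
      (CoordAffine.sum _ fun x _ => ?_)
    exact CoordAffine.prod_one_sub (G x)
      (χ := fun l => x + 2 * l) (fun a b h => by simpa using h) (fun l => e (x + l))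
  have hq : ∀ H : ℕ → ℝ, (∀ u, 1 ≤ H u) → ∀ u, 0 ≤ γ / H u ∧ γ / H u ≤ 1 := by
    intro H hH u
    have := hH u
    exact ⟨by positivity, (div_le_one (by linarith)).2 (by linarith)⟩
  obtain ⟨e, he, -, heF⟩ := (hF1 fun v => γ / B v).exists_round (Finset.range p) _ (hq A hA)
  obtain ⟨f, hf, -, hfF⟩ := (hF2 e).exists_round (Finset.range p) _ (hq B hB)
  simp only [Finset.mem_range] at he hf
  have hp' : (0 : ℝ) < p := by exact_mod_cast hp
  have hstart : F (fun u => γ / A u) (fun v => γ / B v) ≤ 9 / 16 * p := by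
    have hs : ∀ H : ℕ → ℝ, (∀ u, 0 < H u) →
        1 / (4 * γ) * ∑ u ∈ Finset.range p, H u * (γ / H u) = p / 4 := by
      intro H hH
      rw [Finset.sum_congr rfl fun u _ => mul_div_cancel₀ γ (hH u).ne']
      rw [Finset.sum_const, Finset.card_range, nsmul_eq_mul]; field_simp
    have ht : ∑ x ∈ X, ∏ l ∈ G x, (1 - γ / A (x + l) * (γ / B (x + 2 * l))) ≤ 1 / 16 * p := by
      calc _ ≤ ∑ x ∈ X, (1 / 16 : ℝ) := by
            refine Finset.sum_le_sum fun x hx => prod_one_sub_le (fun l _ => ?_) ?_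
            · exact mul_le_one₀ (hq A hA _).2 (hq B hB _).1 (hq B hB _).2
            · refine (hG x hx).trans_eq ?_
              rw [Finset.mul_sum]
              refine Finset.sum_congr rfl fun l _ => ?_
              rw [div_mul_div_comm]; ring
        _ = 1 / 16 * X.card := by rw [Finset.sum_const, nsmul_eq_mul]; ring
        _ ≤ _ := by
            have : (X.card : ℝ) ≤ p := by exact_mod_cast hX
            linarith
    simp only [F]
    rw [hs A hA0, hs B hB0]
    linarith
  have hfin : F e f ≤ 9 / 16 * p := hfF.trans (heF.trans hstart)
  have hsum0 : ∀ H g : ℕ → ℝ, (∀ u, 0 < H u) → (∀ i < p, g i = 0 ∨ g i = 1) →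
      0 ≤ ∑ u ∈ Finset.range p, H u * g u := by
    intro H g hH hg
    refine Finset.sum_nonneg fun u hu => mul_nonneg (hH u).le ?_
    rcases hg u (Finset.mem_range.1 hu) with h | h <;> simp [h]
  have hea := hsum0 A e hA0 he
  have hfb := hsum0 B f hB0 hf
  have hprod : ∀ x ∈ X, 0 ≤ ∏ l ∈ G x, (1 - e (x + l) * f (x + 2 * l)) := by
    intro x hx
    refine Finset.prod_nonneg fun l hl => ?_
    have h2 := hGp x hx l hl
    rcases he (x + l) (by omega) with h | h <;> rcases hf _ h2 with h' | h' <;> simp [h, h']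
  have hpr := Finset.sum_nonneg hprod
  have h4γ : 0 < 1 / (4 * γ) := by positivity
  have hbound : ∀ S : ℝ, 1 / (4 * γ) * S ≤ 9 / 16 * p → S ≤ 9 / 4 * γ * p := by
    intro S hS
    rw [one_div, inv_mul_le_iff₀ (by positivity)] at hS
    linarith
  have hea' := mul_nonneg h4γ.le hea
  have hfb' := mul_nonneg h4γ.le hfb
  simp only [F] at hfin
  refine ⟨e, f, he, hf, hbound _ (by linarith), hbound _ (by linarith),
    X.filter fun x => ∃ l ∈ G x, e (x + l) = 1 ∧ f (x + 2 * l) = 1, Finset.filter_subset _ _, ?_,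
    fun x hx => (Finset.mem_filter.1 hx).2⟩
  have hmiss : ((X.filter fun x => ¬ ∃ l ∈ G x, e (x + l) = 1 ∧ f (x + 2 * l) = 1).card : ℝ) ≤
      ∑ x ∈ X, ∏ l ∈ G x, (1 - e (x + l) * f (x + 2 * l)) := by
    rw [Finset.card_filter]
    push_cast
    refine Finset.sum_le_sum fun x hx => ?_
    split_ifs with h
    · exact hprod x hx
    · refine (Finset.prod_eq_one fun l hl => ?_).ge
      have h2 := hGp x hx l hl
      rcases he (x + l) (by omega) with h3 | h3
      · simp [h3]
      · rcases hf _ h2 with h4 | h4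
        · simp [h4]
        · exact absurd ⟨l, hl, h3, h4⟩ h
  have hcard := Finset.card_filter_add_card_filter_not (s := X)
    (fun x => ∃ l ∈ G x, e (x + l) = 1 ∧ f (x + 2 * l) = 1)
  have hcard' : (((X.filter fun x => ∃ l ∈ G x, e (x + l) = 1 ∧ f (x + 2 * l) = 1).card : ℕ) : ℝ) +
      (X.filter fun x => ¬ ∃ l ∈ G x, e (x + l) = 1 ∧ f (x + 2 * l) = 1).card = X.card := by
    exact_mod_cast hcard
  linarith

/-- The means can be arbitrarily small while the quotient reaches `1` on a fixed proportion of `[0, p)`. -/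
lemma exists_discrete_pair {γ : ℝ} (hγ : 0 < γ) (hγ1 : γ ≤ 1) :
    ∃ p₀ : ℕ, ∀ p ≥ p₀, ∃ Φ Ψ : ℕ → ℝ, (∀ i < p, 0 ≤ Φ i) ∧ (∀ i < p, 0 ≤ Ψ i) ∧
      ∑ u ∈ Finset.range p, Φ u ≤ 9 / 4 * γ * p ∧ ∑ v ∈ Finset.range p, Ψ v ≤ 9 / 4 * γ * p ∧
      ∃ Y ⊆ Finset.range p, (3 / 8 * p : ℝ) ≤ Y.card ∧
        ∀ x ∈ Y, ∃ l, 1 ≤ l ∧ x + 2 * l < p ∧ (l : ℝ) ≤ Φ (x + l) * Ψ (x + 2 * l) := by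
  -- `K` levels give total weight `γ² K / 32 ≥ 15`
  obtain ⟨K, hK⟩ := exists_nat_ge (480 / γ ^ 2)
  obtain ⟨D, hD, hD4, hDK⟩ : ∃ D, 0 < D ∧ 4 ∣ D ∧ 128 * K ≤ D :=
    ⟨128 * K + 4, by omega, by omega, by omega⟩
  refine ⟨64 * D * scaleProd D K ^ 2, fun p hp => ?_⟩
  have hC := scaleProd_pos hD K
  have hp0 : 0 < p := lt_of_lt_of_le (by positivity) hp
  have hXp : innerPoints D K p ⊆ Finset.range p :=
    fun x hx => Finset.mem_range.2 (mem_innerPoints.1 hx).1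
  obtain ⟨e, f, he, hf, h1, h2, Y, hYX, hY, hY'⟩ := exists_sparse_subsets hp0
    (A := fun u => heightΦ D K u) (B := fun v => heightΨ D K v)
    (fun u => by exact_mod_cast heightΦ_pos hD K u) (fun v => by exact_mod_cast heightΨ_pos hD K v)
    hγ hγ1 (innerPoints D K p) (by simpa using Finset.card_le_card hXp) (crossShifts D K) (by
      intro x hx
      have h3 := sum_crossShifts hD hD4 (mem_innerPoints.1 hx).2.2
      have h4 : (0 : ℝ) < γ ^ 2 := by positivity
      rw [div_le_iff₀ h4] at hK
      calc (15 : ℝ) ≤ γ ^ 2 * (K / 32) := by linarith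
        _ ≤ _ := mul_le_mul_of_nonneg_left h3 h4.le) (by
      intro x hx l hl
      have h3 := (mem_innerPoints.1 hx).2.1
      have h4 := (Finset.mem_Icc.1 (Finset.mem_filter.1 hl).1).2
      omega)
  have hnn : ∀ (g : ℕ → ℝ) (H : ℕ → ℕ), (∀ i < p, g i = 0 ∨ g i = 1) →
      ∀ i < p, 0 ≤ (H i : ℝ) * g i := by
    intro g H hg i hi
    rcases hg i hi with h | h <;> simp [h]
  refine ⟨fun u => heightΦ D K u * e u, fun v => heightΨ D K v * f v, hnn e _ he, hnn f _ hf,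
    h1, h2, Y, hYX.trans hXp, ?_, ?_⟩
  · have := card_innerPoints hD hDK hp
    linarith
  · intro x hx
    obtain ⟨l, hl, h3, h4⟩ := hY' x hx
    have hl' := Finset.mem_filter.1 hl
    have h5 := (mem_innerPoints.1 (hYX hx)).2.1
    have h6 := Finset.mem_Icc.1 hl'.1
    refine ⟨l, h6.1, by omega, ?_⟩
    simp only [h3, h4, mul_one]
    exact_mod_cast hl'.2

/-! ### Periodic step functions on the line -/

/-- The `p`-periodic step function on `ℝ` whose value on `[i, i + 1)` is `g i` for `0 ≤ i < p`. -/
noncomputable def stepExtension (p : ℕ) (g : ℕ → ℝ) (x : ℝ) : ℝ := g (⌊x⌋ % (p : ℤ)).toNat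

lemma stepExtension_of_mem {p : ℕ} (g : ℕ → ℝ) {i : ℕ} (hi : i < p) {x : ℝ}
    (hx : x ∈ Set.Ico (i : ℝ) (i + 1)) : stepExtension p g x = g i := by
  have h1 : ⌊x⌋ = (i : ℤ) := Int.floor_eq_iff.2 (by exact_mod_cast hx)
  rw [stepExtension, h1, Int.emod_eq_of_lt (by omega) (by omega), Int.toNat_natCast]

lemma isPeriodicStep_stepExtension {p : ℕ} (hp : 0 < p) {g : ℕ → ℝ} (hg : ∀ i < p, 0 ≤ g i) :
    IsPeriodicStep p (stepExtension p g) where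
  nonneg x := by
    refine hg _ ?_
    have h1 := Int.emod_lt_of_pos ⌊x⌋ (show (0 : ℤ) < p by omega)
    have h2 := Int.emod_nonneg ⌊x⌋ (show (p : ℤ) ≠ 0 by omega)
    omega
  step x := by simp only [stepExtension, Int.floor_intCast]
  periodic x := by
    simp only [stepExtension, Int.floor_add_natCast, Int.add_emod_right]

lemma periodMean_stepExtension (p : ℕ) (g : ℕ → ℝ) :
    periodMean p (stepExtension p g) = 1 / p * ∑ i ∈ Finset.range p, g i := by
  have hIoo : ∀ i < p, ∀ x ∈ Set.Ioo (i : ℝ) (i + 1), stepExtension p g x = g i :=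
    fun i hi x hx => stepExtension_of_mem g hi (Set.Ioo_subset_Ico_self hx)
  have hae : ∀ i < p, ∀ᵐ x, x ∈ Set.uIoc (i : ℝ) ((i + 1 : ℕ) : ℝ) →
      g i = stepExtension p g x := by
    intro i hi
    filter_upwards [Measure.ae_ne volume ((i : ℝ) + 1)] with x hx hx'
    rw [Nat.cast_add_one, Set.uIoc_of_le (by linarith)] at hx'
    exact (hIoo i hi x ⟨hx'.1, lt_of_le_of_ne hx'.2 hx⟩).symm
  have hint : ∀ i < p, IntervalIntegrable (stepExtension p g) volume ((i : ℕ) : ℝ)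
      ((i + 1 : ℕ) : ℝ) := by
    intro i hi
    refine (intervalIntegrable_const (c := g i)).congr_ae ?_
    exact (ae_restrict_iff' measurableSet_uIoc).2 (hae i hi)
  have h := intervalIntegral.sum_integral_adjacent_intervals (a := fun i : ℕ => (i : ℝ)) hint
  rw [periodMean, ← Nat.cast_zero, ← h]
  congr 1
  refine Finset.sum_congr rfl fun i hi => ?_
  rw [← intervalIntegral.integral_congr_ae (hae i (Finset.mem_range.1 hi))]
  simp

lemma card_div_le_relMeasure {p : ℕ} {S : Set ℝ} {Y : Finset ℕ} (hY : Y ⊆ Finset.range p)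
    (hS : ∀ i ∈ Y, Set.Ico (i : ℝ) (i + 1) ⊆ S) : 1 / p * (Y.card : ℝ) ≤ relMeasure p S := by
  refine mul_le_mul_of_nonneg_left ?_ (by positivity)
  have hvol : volume (⋃ i ∈ Y, Set.Ico (i : ℝ) (i + 1)) = Y.card := by
    rw [measure_biUnion_finset]
    · simp
    · intro i _ j _ hij
      rw [Function.onFun, Set.disjoint_left]
      intro x hx hx'
      have h1 : ⌊x⌋ = (i : ℤ) := Int.floor_eq_iff.2 (by exact_mod_cast hx)
      have h2 : ⌊x⌋ = (j : ℤ) := Int.floor_eq_iff.2 (by exact_mod_cast hx')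
      omega
    · exact fun i _ => measurableSet_Ico
  have hsub : (⋃ i ∈ Y, Set.Ico (i : ℝ) (i + 1)) ⊆ S ∩ Set.Ico (0 : ℝ) p := by
    refine Set.iUnion₂_subset fun i hi x hx => ⟨hS i hi hx, ?_, ?_⟩
    · exact (Nat.cast_nonneg i).trans hx.1
    · have h1 : ((i + 1 : ℕ) : ℝ) ≤ p := by exact_mod_cast Finset.mem_range.1 (hY hi)
      push_cast at h1
      exact hx.2.trans_le h1
  have hfin : volume (S ∩ Set.Ico (0 : ℝ) p) ≠ ⊤ :=
    ne_top_of_le_ne_top (by simp) (measure_mono Set.inter_subset_right)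
  have := ENNReal.toReal_mono hfin (measure_mono hsub)
  rwa [hvol, ENNReal.toReal_natCast] at this

/-- Enlarging both functions by constants only enlarges the set where the quotient reaches `1`, so
small means can be turned into prescribed ones. -/
lemma exists_pair_with_means {a b : ℝ} (ha : 0 < a) (hb : 0 < b) :
    ∃ p₀ : ℕ, ∀ p ≥ p₀, ∃ Φ Ψ : ℕ → ℝ, (∀ i < p, 0 ≤ Φ i) ∧ (∀ i < p, 0 ≤ Ψ i) ∧
      1 / p * ∑ u ∈ Finset.range p, Φ u = a ∧ 1 / p * ∑ v ∈ Finset.range p, Ψ v = b ∧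
      ∃ Y ⊆ Finset.range p, (3 / 8 * p : ℝ) ≤ Y.card ∧
        ∀ x ∈ Y, ∃ l, 1 ≤ l ∧ x + 2 * l < p ∧ (l : ℝ) ≤ Φ (x + l) * Ψ (x + 2 * l) := by
  obtain ⟨γ, hγ, hγ1, hγa, hγb⟩ : ∃ γ : ℝ, 0 < γ ∧ γ ≤ 1 ∧ 9 / 4 * γ ≤ a ∧ 9 / 4 * γ ≤ b :=
    ⟨min 1 (min (4 / 9 * a) (4 / 9 * b)), by positivity, min_le_left _ _,
      by linarith [(min_le_right 1 (min (4 / 9 * a) (4 / 9 * b))).trans (min_le_left _ _)],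
      by linarith [(min_le_right 1 (min (4 / 9 * a) (4 / 9 * b))).trans (min_le_right _ _)]⟩
  obtain ⟨p₀, h⟩ := exists_discrete_pair hγ hγ1
  refine ⟨max p₀ 1, fun p hp => ?_⟩
  obtain ⟨Φ, Ψ, hΦ, hΨ, hsΦ, hsΨ, Y, hYp, hY, hY'⟩ := h p (le_of_max_le_left hp)
  have hp0 : (0 : ℝ) < p := by exact_mod_cast le_of_max_le_right hp
  obtain ⟨x, hx⟩ : Y.Nonempty := by
    rw [← Finset.card_pos]
    have : (0 : ℝ) < Y.card := by linarith
    exact_mod_cast this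
  obtain ⟨l, hl1, hlp, hl⟩ := hY' x hx
  have hprod : 0 < Φ (x + l) * Ψ (x + 2 * l) :=
    lt_of_lt_of_le (by exact_mod_cast hl1) hl
  have hxl : x + l < p := by omega
  have hΦpos : 0 < ∑ u ∈ Finset.range p, Φ u :=
    Finset.sum_pos' (fun i hi => hΦ i (Finset.mem_range.1 hi))
      ⟨x + l, Finset.mem_range.2 hxl, pos_of_mul_pos_left hprod (hΨ _ hlp)⟩
  have hΨpos : 0 < ∑ v ∈ Finset.range p, Ψ v :=
    Finset.sum_pos' (fun i hi => hΨ i (Finset.mem_range.1 hi))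
      ⟨x + 2 * l, Finset.mem_range.2 hlp, pos_of_mul_pos_right hprod (hΦ _ hxl)⟩
  set SΦ := ∑ u ∈ Finset.range p, Φ u
  set SΨ := ∑ v ∈ Finset.range p, Ψ v
  have h1 : 1 ≤ a * p / SΦ := by
    rw [le_div_iff₀ hΦpos, one_mul]
    exact hsΦ.trans (mul_le_mul_of_nonneg_right hγa hp0.le)
  have h2 : 1 ≤ b * p / SΨ := by
    rw [le_div_iff₀ hΨpos, one_mul]
    exact hsΨ.trans (mul_le_mul_of_nonneg_right hγb hp0.le)
  refine ⟨fun u => a * p / SΦ * Φ u, fun v => b * p / SΨ * Ψ v,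
    fun i hi => mul_nonneg (by linarith) (hΦ i hi), fun i hi => mul_nonneg (by linarith) (hΨ i hi),
    ?_, ?_, Y, hYp, hY, fun y hy => ?_⟩
  · rw [← Finset.mul_sum]; field_simp; rfl
  · rw [← Finset.mul_sum]; field_simp; rfl
  · obtain ⟨m, hm1, hmp, hm⟩ := hY' y hy
    refine ⟨m, hm1, hmp, hm.trans ?_⟩
    exact mul_le_mul (le_mul_of_one_le_left (hΦ _ (by omega)) h1)
      (le_mul_of_one_le_left (hΨ _ hmp) h2) (hΨ _ hmp)
      (mul_nonneg (by linarith) (hΦ _ (by omega)))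

theorem theorem2p3 (ρ ε : ℝ) (hρ : 1 / 2 < ρ) (hρ' : ρ < 1) (hε : 0 < ε) (hε' : ε < 1 / 10)
    (M : ℕ) (hM : 2 ≤ M) (P : Set ℕ) (hP : P.Infinite) (α s : ℕ) (hα : 1 ≤ α) (hs : 1 ≤ s) :
    Nonempty (AlphaPSFamily ρ ε M α P s) := by
  have hs0 : (0 : ℝ) < s := by exact_mod_cast hs
  have ha : 0 < (s : ℝ) * (2 : ℝ) ^ (-(M : ℤ)) := by positivity
  have hb : 0 < (1 + ρ) / 2 * ε := mul_pos (by linarith) hε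
  obtain ⟨p₀, h⟩ := exists_pair_with_means ha hb
  obtain ⟨p, hpP, hp⟩ := hP.exists_gt (max p₀ α)
  have hpα : α ≤ p := (le_max_right _ _).trans hp.le
  have hp0 : 0 < p := by omega
  have hpR : (0 : ℝ) < p := by exact_mod_cast hp0
  obtain ⟨Φ, Ψ, hΦ, hΨ, hmΦ, hmΨ, Y, hYp, hY, hY'⟩ := h p ((le_max_left _ _).trans hp.le)
  -- one function of each kind suffices, and `3 / 8 > ε`
  refine ⟨{ n := 1, ω := α, p := p, φ := fun _ => stepExtension p Φ, ψ := fun _ => stepExtension p Ψ,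
            α_le_ω := le_rfl, p_mem := hpP, ω_le_p := hpα,
            φ_step := fun _ _ => isPeriodicStep_stepExtension hp0 hΦ,
            ψ_step := fun _ _ => isPeriodicStep_stepExtension hp0 hΨ,
            relMeasure_gt := ?_, lt_sum_φ := ?_, sum_φ_lt := ?_, lt_sum_ψ := ?_, sum_ψ_lt := ?_ }⟩
  · refine lt_of_le_of_lt (min_le_left _ _) (lt_of_lt_of_le ?_ (card_div_le_relMeasure hYp ?_))
    · have h1 : 1 / (p : ℝ) * (3 / 8 * p) ≤ 1 / p * Y.card :=
        mul_le_mul_of_nonneg_left hY (by positivity)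
      have h2 : 1 / (p : ℝ) * (3 / 8 * p) = 3 / 8 := by field_simp
      linarith
    · intro i hi x hx
      obtain ⟨l, hl1, hlp, hl⟩ := hY' i hi
      refine ⟨α, Finset.mem_Icc.2 ⟨le_rfl, le_rfl⟩, l, Finset.mem_Icc.2 ⟨hl1, by omega⟩, ?_⟩
      have e1 : stepExtension p Φ (x + l) = Φ (i + l) :=
        stepExtension_of_mem Φ (by omega)
          ⟨by push_cast; linarith [hx.1], by push_cast; linarith [hx.2]⟩
      have e2 : stepExtension p Ψ (x + 2 * l) = Ψ (i + 2 * l) :=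
        stepExtension_of_mem Ψ hlp
          ⟨by push_cast; linarith [hx.1], by push_cast; linarith [hx.2]⟩
      have hl0 : (0 : ℝ) < l := by exact_mod_cast hl1
      simp only [Finset.Icc_self, Finset.sum_singleton]
      rw [e1, e2, le_div_iff₀ hl0, one_mul]
      exact hl
  all_goals
    simp only [Finset.Icc_self, Finset.sum_singleton, periodMean_stepExtension, hmΦ, hmΨ]
  · rw [zpow_sub_one₀ two_ne_zero]; linarith
  · rw [zpow_add_one₀ two_ne_zero]; linarith
  · nlinarith
  · nlinarith
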